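/- Let $X$ be a finite set and $\mathbb F_X$ the free group on $X$, and let $B_n$ be the set of elements of $\mathbb F_X$ whose reduced word has length at most $n$. For $S\subseteq\mathbb F_X$ define the lower and upper Banach densities $$\underline\mu(S)=\liminf_{n\to\infty}\min_{\omega\in\mathbb F_X}\frac{|S\cap\omega B_n|}{|B_n|},\qquad \overline\mu(S)=\limsup_{n\to\infty}\max_{\omega\in\mathbb F_X}\frac{|S\cap\omega B_n|}{|B_n|}.$$ Call $S$ LB-generic if $\underline\mu(S)=1$, and LB-negligible if its complement $\mathbb F_X\setminus S$ is LB-generic. Theorem. Let $\Gamma$ be an infinite group generated by a finite subset $X\subseteq\Gamma$, and let $\pi:\mathbb F_X\to\Gamma$ be the canonical projection, that is, the homomorphism sending each generator $x\in X$ to the element $x$ of $\Gamma$. Then $\overline\mu(\ker\pi)=0$. Equivalently, $\ker\pi$ is LB-negligible. -/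

import Mathlib

open Filter
open scoped Pointwise

/-- The ball `B_n` of radius `n` about the empty word in the free group on `α`: all reduced words
of length at most `n`. -/
def freeBall (α : Type*) [DecidableEq α] (n : ℕ) : Set (FreeGroup α) :=
  {w | w.norm ≤ n}

/-- The proportion `|S ∩ ω B_n| / |B_n|`. -/
noncomputable def ballRatio {α : Type*} [DecidableEq α] (S : Set (FreeGroup α)) (n : ℕ)
    (ω : FreeGroup α) : ℝ :=
  ((S ∩ ω • freeBall α n).ncard : ℝ) / ((freeBall α n).ncard : ℝ)

/-- The lower Banach density: liminf over `n` of the minimum over `ω` of `|S ∩ ω B_n| / |B_n|`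
(for finite `α` the infimum is attained, see `ballRatio_iInf_isLeast`). -/
noncomputable def lowerBanachDensity {α : Type*} [DecidableEq α] (S : Set (FreeGroup α)) : ℝ :=
  liminf (fun n : ℕ => ⨅ ω : FreeGroup α, ballRatio S n ω) atTop

/-- The upper Banach density: limsup over `n` of the maximum over `ω` of `|S ∩ ω B_n| / |B_n|`
(for finite `α` the supremum is attained, see `ballRatio_iSup_isGreatest`). -/
noncomputable def upperBanachDensity {α : Type*} [DecidableEq α] (S : Set (FreeGroup α)) : ℝ :=
  limsup (fun n : ℕ => ⨆ ω : FreeGroup α, ballRatio S n ω) atTop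

/-- Lower Banach generic sets: lower Banach density one. -/
def IsLBGeneric {α : Type*} [DecidableEq α] (S : Set (FreeGroup α)) : Prop :=
  lowerBanachDensity S = 1

/-- Lower Banach negligible sets: the complement is lower Banach generic. -/
def IsLBNegligible {α : Type*} [DecidableEq α] (N : Set (FreeGroup α)) : Prop :=
  IsLBGeneric Nᶜ

/-- The canonical projection from the free group on a subset `X` of `Γ` to `Γ`. -/
def canonicalProj {Γ : Type*} [Group Γ] (X : Finset Γ) : FreeGroup X →* Γ :=
  FreeGroup.lift (fun x : X => (x : Γ))

theorem freeBall_finite (α : Type*) [DecidableEq α] [Finite α] (n : ℕ) :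
    (freeBall α n).Finite := by
  have h : {l : List (α × Bool) | l.length ≤ n}.Finite := List.finite_length_le _ n
  exact h.preimage FreeGroup.toWord_injective.injOn

theorem ballRatio_range_finite {α : Type*} [DecidableEq α] [Finite α] (S : Set (FreeGroup α))
    (n : ℕ) : (Set.range (ballRatio S n)).Finite := by
  refine ((Set.finite_Iic (freeBall α n).ncard).image
    (fun k : ℕ => (k : ℝ) / ((freeBall α n).ncard : ℝ))).subset ?_
  rintro _ ⟨ω, rfl⟩
  refine ⟨(S ∩ ω • freeBall α n).ncard, ?_, rfl⟩
  have h : (ω • freeBall α n).ncard = (freeBall α n).ncard :=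
    Set.ncard_image_of_injective _ (MulAction.injective ω)
  rw [Set.mem_Iic, ← h]
  exact Set.ncard_le_ncard Set.inter_subset_right ((freeBall_finite α n).smul_set)

theorem ballRatio_iSup_isGreatest {α : Type*} [DecidableEq α] [Finite α]
    (S : Set (FreeGroup α)) (n : ℕ) :
    IsGreatest (Set.range (ballRatio S n)) (⨆ ω, ballRatio S n ω) :=
  ⟨(Set.range_nonempty _).csSup_mem (ballRatio_range_finite S n),
    fun _ hx => le_csSup (ballRatio_range_finite S n).bddAbove hx⟩

theorem ballRatio_iInf_isLeast {α : Type*} [DecidableEq α] [Finite α]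
    (S : Set (FreeGroup α)) (n : ℕ) :
    IsLeast (Set.range (ballRatio S n)) (⨅ ω, ballRatio S n ω) :=
  ⟨(Set.range_nonempty _).csInf_mem (ballRatio_range_finite S n),
    fun _ hx => csInf_le (ballRatio_range_finite S n).bddBelow hx⟩

/-! Since `ω⁻¹` carries `ker π ∩ ωB_n` onto a fibre of `π` in `B_n`, it suffices that fibres over
all `g` take a uniformly small share of `B_n`.

With at least two generators, let `q = 2|X| - 1`, the number of continuations of a letter. Suppose
`K` words of length `L` follow `p`, end in a common letter and have distinct images. Their
continuations reaching a fixed `g` are disjoint sets of words, so together they number at most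
`q^n`. A uniform bound `C` on the proportions at length `n` thus becomes `1/q^L + (1 - K/q^L) C` at
length `L + n` (`pathCount_add_le`). Iterating brings the bound near `1/K`, and `K` is arbitrary.

Such words exist because `Γ` is infinite (`exists_loops_quotient_notMem`): otherwise every `φ(w)`
would agree, up to a finite set, with a power of one generator's image, and that image would have
finite order. With one generator, `π` is injective and fibres have at most one point. -/

theorem FreeGroup.mk_cons {α : Type*} (x : α × Bool) (u : List (α × Bool)) :
    FreeGroup.mk (x :: u) = FreeGroup.mk [x] * FreeGroup.mk u := by
  rw [FreeGroup.mul_mk, List.singleton_append]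

/-! ### Reduced words as non-backtracking paths of letters -/

section Words

variable {α : Type*} [Fintype α] [DecidableEq α]

/-- The letters which may follow the letter `p` in a reduced word. -/
def nextLetters (p : α × Bool) : Finset (α × Bool) :=
  Finset.univ.filter fun x => p.1 = x.1 → p.2 = x.2

theorem mem_nextLetters {p x : α × Bool} :
    x ∈ nextLetters p ↔ (p.1 = x.1 → p.2 = x.2) := by
  simp [nextLetters]

theorem mem_nextLetters_comm {p x : α × Bool} : x ∈ nextLetters p ↔ p ∈ nextLetters x := by
  simp only [mem_nextLetters, eq_comm]

theorem self_mem_nextLetters (p : α × Bool) : p ∈ nextLetters p :=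
  mem_nextLetters.2 fun _ => rfl

theorem nextLetters_eq_erase (p : α × Bool) :
    nextLetters p = Finset.univ.erase (p.1, !p.2) := by
  ext ⟨x, b⟩
  obtain ⟨y, c⟩ := p
  simp only [mem_nextLetters, Finset.mem_erase, Finset.mem_univ, and_true, ne_eq, Prod.mk.injEq,
    not_and]
  constructor
  · rintro h rfl
    cases b <;> cases c <;> simp_all
  · rintro h rfl
    cases b <;> cases c <;> simp_all

theorem card_nextLetters (p : α × Bool) :
    (nextLetters p).card = 2 * Fintype.card α - 1 := by
  rw [nextLetters_eq_erase, Finset.card_erase_of_mem (Finset.mem_univ _), Finset.card_univ,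
    Fintype.card_prod, Fintype.card_bool, mul_comm]

/-- With at least two generators any two letters can be joined through an intermediate letter. -/
theorem exists_mem_nextLetters (hα : 2 ≤ Fintype.card α) (p x : α × Bool) :
    ∃ y ∈ nextLetters p, x ∈ nextLetters y := by
  -- Only the inverses of `p` and `x` are forbidden, and there are at least four letters.
  have h : ({(p.1, !p.2), (x.1, !x.2)} : Finset (α × Bool)).card
      < (Finset.univ : Finset (α × Bool)).card := by
    refine Finset.card_le_two.trans_lt ?_
    rw [Finset.card_univ, Fintype.card_prod, Fintype.card_bool]
    omega
  obtain ⟨y, -, hy⟩ := Finset.exists_mem_notMem_of_card_lt_card h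
  simp only [Finset.mem_insert, Finset.mem_singleton, not_or] at hy
  refine ⟨y, ?_, ?_⟩
  · rw [nextLetters_eq_erase]
    exact Finset.mem_erase.2 ⟨hy.1, Finset.mem_univ _⟩
  · refine mem_nextLetters.2 fun h => ?_
    by_contra hne
    refine hy.2 (Prod.ext h ?_)
    revert hne
    cases y.2 <;> cases x.2 <;> simp

/-- The words `u` of length `n` such that `p :: u` is reduced. -/
def pathWords : ℕ → α × Bool → Finset (List (α × Bool))
  | 0, _ => {[]}
  | n + 1, p => (nextLetters p).biUnion fun x => (pathWords n x).image (List.cons x)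

theorem mem_pathWords_zero {p : α × Bool} {u : List (α × Bool)} :
    u ∈ pathWords 0 p ↔ u = [] := by
  simp [pathWords]

theorem cons_mem_pathWords {n : ℕ} {p x : α × Bool} {u : List (α × Bool)} :
    x :: u ∈ pathWords (n + 1) p ↔ x ∈ nextLetters p ∧ u ∈ pathWords n x := by
  simp only [pathWords, Finset.mem_biUnion, Finset.mem_image, List.cons.injEq]
  constructor
  · rintro ⟨y, hy, v, hv, rfl, rfl⟩
    exact ⟨hy, hv⟩
  · rintro ⟨h1, h2⟩
    exact ⟨x, h1, u, h2, rfl, rfl⟩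

theorem mem_pathWords {n : ℕ} {p : α × Bool} {u : List (α × Bool)} :
    u ∈ pathWords n p ↔ u.length = n ∧ FreeGroup.IsReduced (p :: u) := by
  induction n generalizing p u with
  | zero =>
    rw [mem_pathWords_zero, List.length_eq_zero_iff]
    constructor
    · rintro rfl
      simp [FreeGroup.IsReduced]
    · exact fun h => h.1
  | succ n ih =>
    cases u with
    | nil => simp [pathWords]
    | cons x u =>
      rw [cons_mem_pathWords, ih, mem_nextLetters, List.length_cons, Nat.add_right_cancel_iff]
      simp only [FreeGroup.IsReduced, List.isChain_cons_cons]
      tauto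

theorem sum_pathWords_succ {M : Type*} [AddCommMonoid M] (n : ℕ) (p : α × Bool)
    (F : List (α × Bool) → M) :
    ∑ u ∈ pathWords (n + 1) p, F u =
      ∑ x ∈ nextLetters p, ∑ u ∈ pathWords n x, F (x :: u) := by
  rw [pathWords, Finset.sum_biUnion]
  · refine Finset.sum_congr rfl fun x _ => ?_
    rw [Finset.sum_image fun _ _ _ _ h => List.tail_eq_of_cons_eq h]
  · intro x _ y _ hxy
    refine Finset.disjoint_left.2 fun u hu hu' => hxy ?_
    obtain ⟨v, -, rfl⟩ := Finset.mem_image.1 hu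
    obtain ⟨w, -, h⟩ := Finset.mem_image.1 hu'
    exact (List.head_eq_of_cons_eq h).symm

theorem card_pathWords (n : ℕ) (p : α × Bool) :
    (pathWords n p).card = (2 * Fintype.card α - 1) ^ n := by
  induction n generalizing p with
  | zero => simp [pathWords]
  | succ n ih =>
    rw [Finset.card_eq_sum_ones, sum_pathWords_succ]
    simp_rw [← Finset.card_eq_sum_ones, ih, Finset.sum_const, card_nextLetters]
    rw [smul_eq_mul, pow_succ']

/-- The default `p` in `getLastD` covers empty `u`: then `v` follows `p` itself. -/
theorem append_mem_pathWords {m n : ℕ} {p : α × Bool} {u v : List (α × Bool)}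
    (hu : u ∈ pathWords m p) (hv : v ∈ pathWords n (u.getLastD p)) :
    u ++ v ∈ pathWords (m + n) p := by
  induction m generalizing p u with
  | zero =>
    obtain rfl := mem_pathWords_zero.1 hu
    simpa using hv
  | succ m ih =>
    cases u with
    | nil => simp [pathWords] at hu
    | cons x u =>
      rw [cons_mem_pathWords] at hu
      rw [List.cons_append, Nat.add_right_comm, cons_mem_pathWords]
      exact ⟨hu.1, ih hu.2 (by rwa [List.getLastD_cons] at hv)⟩

theorem getLastD_append_eq {β : Type*} (u v : List β) (p : β) :
    (u ++ v).getLastD p = v.getLastD (u.getLastD p) := by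
  induction u generalizing p with
  | nil => simp
  | cons x u ih => rw [List.cons_append, List.getLastD_cons, ih, List.getLastD_cons]

theorem replicate_mem_pathWords (n : ℕ) (p : α × Bool) :
    List.replicate n p ∈ pathWords n p := by
  induction n with
  | zero => simp [pathWords]
  | succ n ih =>
    rw [List.replicate_succ, cons_mem_pathWords]
    exact ⟨self_mem_nextLetters p, ih⟩

/-- A reduced word and the power of `a` of the same length can be completed to closed paths at the
letter `a`, adding the same letters to both. -/
theorem exists_paths_through (hα : 2 ≤ Fintype.card α) (a : α × Bool) {w : List (α × Bool)}
    (hw : FreeGroup.IsReduced w) :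
    ∃ f e : α × Bool, f :: (w ++ [e, a]) ∈ pathWords (w.length + 3) a ∧
      f :: (List.replicate w.length a ++ [e, a]) ∈ pathWords (w.length + 3) a := by
  obtain ⟨f, hf, hfw⟩ : ∃ f ∈ nextLetters a, w ∈ pathWords w.length f := by
    cases w with
    | nil => exact ⟨a, self_mem_nextLetters a, by simp [pathWords]⟩
    | cons x t =>
      obtain ⟨f, hf, hx⟩ := exists_mem_nextLetters hα a x
      exact ⟨f, hf, cons_mem_pathWords.2 ⟨hx, mem_pathWords.2 ⟨rfl, hw⟩⟩⟩
  obtain ⟨e, he, ha⟩ := exists_mem_nextLetters hα (w.getLastD f) a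
  have key {v : List (α × Bool)} (hv : v ∈ pathWords w.length f)
      (h : e ∈ nextLetters (v.getLastD f)) :
      f :: (v ++ [e, a]) ∈ pathWords (w.length + 3) a :=
    cons_mem_pathWords.2 ⟨hf, append_mem_pathWords hv
      (cons_mem_pathWords.2 ⟨h, cons_mem_pathWords.2 ⟨ha, mem_pathWords_zero.2 rfl⟩⟩)⟩
  refine ⟨f, e, key hfw he, key ?_ ?_⟩
  · cases w.length with
    | zero => simp [pathWords]
    | succ n =>
      exact cons_mem_pathWords.2 ⟨mem_nextLetters_comm.1 hf, replicate_mem_pathWords n a⟩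
  · have hl (n : ℕ) : (List.replicate (n + 1) a).getLastD f = a := by
      rw [List.replicate_succ', getLastD_append_eq]
      rfl
    cases h : w.length with
    | zero =>
      rw [List.length_eq_zero_iff] at h
      simpa [h] using he
    | succ n =>
      rw [hl]
      exact mem_nextLetters_comm.1 ha

end Words

/-! ### Counting paths by image; the contraction estimate -/

section Counting

variable {α Γ : Type*} [Fintype α] [DecidableEq α] [Group Γ] [DecidableEq Γ]

/-- The number of words `u` of length `n` with `p :: u` reduced whose image is `g`. -/
def pathCount (φ : FreeGroup α →* Γ) (n : ℕ) (p : α × Bool) (g : Γ) : ℕ :=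
  ((pathWords n p).filter fun u => φ (FreeGroup.mk u) = g).card

theorem pathCount_eq_sum (φ : FreeGroup α →* Γ) (n : ℕ) (p : α × Bool) (g : Γ) :
    pathCount φ n p g = ∑ u ∈ pathWords n p, if φ (FreeGroup.mk u) = g then 1 else 0 := by
  rw [pathCount, Finset.card_filter]

theorem pathCount_le (φ : FreeGroup α →* Γ) (n : ℕ) (p : α × Bool) (g : Γ) :
    pathCount φ n p g ≤ (2 * Fintype.card α - 1) ^ n :=
  (Finset.card_filter_le _ _).trans_eq (card_pathWords n p)

/-- Markov property: after a prefix, only its last letter and its image matter. -/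
theorem pathCount_add (φ : FreeGroup α →* Γ) (m n : ℕ) (p : α × Bool) (g : Γ) :
    pathCount φ (m + n) p g = ∑ u ∈ pathWords m p,
      pathCount φ n (u.getLastD p) ((φ (FreeGroup.mk u))⁻¹ * g) := by
  induction m generalizing p g with
  | zero => simp [pathWords, ← FreeGroup.one_eq_mk]
  | succ m ih =>
    rw [Nat.add_right_comm, pathCount_eq_sum, sum_pathWords_succ, sum_pathWords_succ]
    refine Finset.sum_congr rfl fun x _ => ?_
    have h (u : List (α × Bool)) : φ (FreeGroup.mk (x :: u)) = g ↔
        φ (FreeGroup.mk u) = (φ (FreeGroup.mk [x]))⁻¹ * g := by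
      rw [FreeGroup.mk_cons, map_mul, eq_inv_mul_iff_mul_eq]
    simp_rw [h]
    rw [← pathCount_eq_sum, ih]
    refine Finset.sum_congr rfl fun u _ => ?_
    rw [List.getLastD_cons, FreeGroup.mk_cons x u, map_mul, mul_inv_rev, mul_assoc]

/-- Words with distinct images meet disjoint sets of continuations. -/
theorem sum_pathCount_le_of_injOn (φ : FreeGroup α →* Γ) (n : ℕ) (a : α × Bool) (g : Γ)
    {U : Finset (List (α × Bool))} (hU : Set.InjOn (fun u => φ (FreeGroup.mk u)) U) :
    ∑ u ∈ U, pathCount φ n a ((φ (FreeGroup.mk u))⁻¹ * g) ≤ (2 * Fintype.card α - 1) ^ n := by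
  simp_rw [pathCount]
  rw [← Finset.card_biUnion, ← card_pathWords n a]
  · exact Finset.card_le_card (Finset.biUnion_subset.2 fun _ _ => Finset.filter_subset _ _)
  · intro u hu v hv huv
    refine Finset.disjoint_left.2 fun w hw hw' => huv (hU hu hv ?_)
    have h := (Finset.mem_filter.1 hw).2.symm.trans (Finset.mem_filter.1 hw').2
    exact inv_injective (mul_right_cancel h)

/-- If there are `k` words of length `L` following `p` with a common last letter and distinct images,
then a uniform bound `C` on the proportions at length `n` improves at length `L + n`. -/
theorem pathCount_add_le (φ : FreeGroup α →* Γ) {L k n : ℕ} {a p : α × Bool}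
    {U : Finset (List (α × Bool))} (hUL : U ⊆ pathWords L p) (hUa : ∀ u ∈ U, u.getLastD p = a)
    (hU : Set.InjOn (fun u => φ (FreeGroup.mk u)) U) (hk : U.card = k) {C : ℝ}
    (hC : ∀ p g, (pathCount φ n p g : ℝ) ≤ C * ((2 * Fintype.card α - 1 : ℕ) : ℝ) ^ n) (g : Γ) :
    (pathCount φ (L + n) p g : ℝ) ≤
      (1 + (((2 * Fintype.card α - 1 : ℕ) : ℝ) ^ L - k) * C) *
        ((2 * Fintype.card α - 1 : ℕ) : ℝ) ^ n := by
  -- Prefixes in `U` cost at most `q^n` altogether; each of the `q^L - k` others costs at most `C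
  -- q^n`.
  rw [pathCount_add, ← Finset.sum_sdiff hUL, Nat.cast_add, add_comm, add_mul]
  have h1 : ∑ u ∈ U, pathCount φ n (u.getLastD p) ((φ (FreeGroup.mk u))⁻¹ * g) ≤
      (2 * Fintype.card α - 1) ^ n := by
    rw [Finset.sum_congr rfl fun u hu => by rw [hUa u hu]]
    exact sum_pathCount_le_of_injOn φ n a g hU
  refine add_le_add ?_ ?_
  · rw [one_mul]
    exact_mod_cast h1
  · rw [Nat.cast_sum]
    refine (Finset.sum_le_card_nsmul _ _ _ fun u _ => hC _ _).trans_eq ?_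
    rw [nsmul_eq_mul, Finset.card_sdiff_of_subset hUL,
      Nat.cast_sub (Finset.card_le_card hUL), card_pathWords, hk, Nat.cast_pow]
    ring

theorem pathCount_succ_le (φ : FreeGroup α →* Γ) {n : ℕ} {C : ℝ}
    (hC : ∀ p g, (pathCount φ n p g : ℝ) ≤ C * ((2 * Fintype.card α - 1 : ℕ) : ℝ) ^ n)
    (p : α × Bool) (g : Γ) :
    (pathCount φ (n + 1) p g : ℝ) ≤ C * ((2 * Fintype.card α - 1 : ℕ) : ℝ) ^ (n + 1) := by
  rw [add_comm n 1, pathCount_add, Nat.cast_sum]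
  refine (Finset.sum_le_card_nsmul _ _ _ fun u _ => hC _ _).trans_eq ?_
  rw [nsmul_eq_mul, card_pathWords, Nat.cast_pow]
  ring

end Counting

theorem FreeGroup.mk_replicate {α : Type*} (n : ℕ) (a : α × Bool) :
    FreeGroup.mk (List.replicate n a) = FreeGroup.mk [a] ^ n := by
  induction n with
  | zero => rw [List.replicate_zero, pow_zero, FreeGroup.one_eq_mk]
  | succ n ih => rw [List.replicate_succ, FreeGroup.mk_cons, ih, pow_succ']

theorem FreeGroup.mk_singleton_not {α : Type*} (a : α × Bool) :
    FreeGroup.mk [(a.1, !a.2)] = (FreeGroup.mk [a])⁻¹ := by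
  rw [FreeGroup.inv_mk]
  simp [FreeGroup.invRev]

/-! ### Many equal-length paths with distinct images -/

section Loops

variable {α Γ : Type*} [Fintype α] [DecidableEq α] [Group Γ]

/-- Closed paths of equal length at a letter have images whose quotients do not lie in any given
finite set. -/
theorem exists_loops_quotient_notMem [Infinite Γ] {φ : FreeGroup α →* Γ}
    (hφ : Function.Surjective φ) (hα : 2 ≤ Fintype.card α) (a : α × Bool) {T : Set Γ}
    (hT : T.Finite) :
    ∃ (n : ℕ) (v v' : List (α × Bool)), v ∈ pathWords n a ∧ v' ∈ pathWords n a ∧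
      v.getLastD a = a ∧ v'.getLastD a = a ∧
      φ (FreeGroup.mk v) * (φ (FreeGroup.mk v'))⁻¹ ∉ T := by
  by_contra! hcon
  set t := φ (FreeGroup.mk [a]) with ht
  set S : Set Γ := Set.range fun x : α × Bool => φ (FreeGroup.mk [x])
  have hS : S.Finite := Set.finite_range _
  have hlast (f e : α × Bool) (w : List (α × Bool)) : (f :: (w ++ [e, a])).getLastD a = a := by
    rw [List.getLastD_cons, getLastD_append_eq]
    rfl
  -- Closing `w` and `a^|w|` with the same letters `f`, `e`, `a` makes the tails cancel in the
  -- quotient, leaving a conjugate by the image of `f`.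
  have key (w : List (α × Bool)) (hw : FreeGroup.IsReduced w) :
      φ (FreeGroup.mk w) * (t ^ w.length)⁻¹ ∈ S⁻¹ * T * S := by
    obtain ⟨f, e, h1, h2⟩ := exists_paths_through hα a hw
    have h := hcon _ _ _ h1 h2 (hlast _ _ _) (hlast _ _ _)
    rw [FreeGroup.mk_cons f (w ++ _), FreeGroup.mk_cons f (_ ++ _), ← FreeGroup.mul_mk (L₁ := w),
      ← FreeGroup.mul_mk (L₁ := List.replicate _ _), FreeGroup.mk_replicate] at h
    simp only [map_mul, map_pow] at h
    refine Set.mem_mul.2 ⟨_, Set.mul_mem_mul (Set.inv_mem_inv.2 (Set.mem_range_self f)) h, _,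
      Set.mem_range_self f, ?_⟩
    simp only [ht]
    group
  have hfin : (S⁻¹ * T * S).Finite := (hS.inv.mul hT).mul hS
  have hpow : IsOfFinOrder t := by
    -- Apply `key` to the word `a⁻ⁿ`, whose comparison power is `tⁿ`.
    have hmaps (n : ℕ) : (t ^ (2 * n))⁻¹ ∈ S⁻¹ * T * S := by
      have hred : FreeGroup.IsReduced (List.replicate n (a.1, !a.2)) :=
        (mem_pathWords.1 (replicate_mem_pathWords n (a.1, !a.2))).2.tail
      have h := key _ hred
      rwa [FreeGroup.mk_replicate, FreeGroup.mk_singleton_not, List.length_replicate, map_pow,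
        map_inv, ← ht, inv_pow, ← mul_inv_rev, ← pow_add, ← two_mul] at h
    by_contra hinf
    have hinj : Function.Injective fun n : ℕ => (t ^ (2 * n))⁻¹ := fun m n h => by
      have := injective_pow_iff_not_isOfFinOrder.2 hinf (inv_injective h)
      omega
    exact Set.infinite_range_of_injective hinj
      (hfin.subset (Set.range_subset_iff.2 hmaps))
  refine Set.infinite_univ (α := Γ) ((hfin.mul (finite_powers.2 hpow)).subset fun g _ => ?_)
  obtain ⟨x, rfl⟩ := hφ g
  refine Set.mem_mul.2 ⟨_, key x.toWord FreeGroup.isReduced_toWord, t ^ x.toWord.length,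
    ⟨_, rfl⟩, ?_⟩
  rw [inv_mul_cancel_right, FreeGroup.mk_toWord]

/-- There are arbitrarily many closed paths of equal length at a letter with distinct images. -/
theorem exists_loops_injOn [Infinite Γ] {φ : FreeGroup α →* Γ}
    (hφ : Function.Surjective φ) (hα : 2 ≤ Fintype.card α) (a : α × Bool) (k : ℕ) :
    ∃ (L : ℕ) (U : Finset (List (α × Bool))), U ⊆ pathWords L a ∧ (∀ u ∈ U, u.getLastD a = a) ∧
      Set.InjOn (fun u => φ (FreeGroup.mk u)) U ∧ U.card = k + 1 := by
  induction k with
  | zero => exact ⟨0, {[]}, by simp [pathWords], by simp, by simp, by simp⟩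
  | succ k ih =>
    obtain ⟨L, U, hUL, hUa, hU, hk⟩ := ih
    set A : Set Γ := (fun u => φ (FreeGroup.mk u)) '' (U : Set (List (α × Bool))) with hA
    have hAfin : A.Finite := U.finite_toSet.image _
    -- Extend all of `U` by `v'` and one `u₀` also by `v`. A collision of `u₀v` with some `uv'`
    -- would put the quotient in `A⁻¹A`.
    obtain ⟨n, v, v', hv, hv', hva, hva', hT⟩ :=
      exists_loops_quotient_notMem hφ hα a (hAfin.inv.mul hAfin)
    obtain ⟨u₀, hu₀⟩ : U.Nonempty := Finset.card_pos.1 (by omega)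
    have hne (u : List (α × Bool)) (hu : u ∈ U) :
        φ (FreeGroup.mk (u ++ v')) ≠ φ (FreeGroup.mk (u₀ ++ v)) := by
      intro h
      refine hT (Set.mem_mul.2 ⟨_, Set.inv_mem_inv.2 (Set.mem_image_of_mem _ hu₀), _,
        Set.mem_image_of_mem _ hu, ?_⟩)
      rw [← FreeGroup.mul_mk, ← FreeGroup.mul_mk, map_mul, map_mul] at h
      rw [eq_mul_inv_iff_mul_eq, mul_assoc, inv_mul_eq_iff_eq_mul]
      exact h
    have hinj : Function.Injective fun u : List (α × Bool) => u ++ v' :=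
      List.append_left_injective v'
    refine ⟨L + n, insert (u₀ ++ v) (U.image fun u => u ++ v'), ?_, ?_, ?_, ?_⟩
    · refine Finset.insert_subset_iff.2 ⟨append_mem_pathWords (hUL hu₀) (by rwa [hUa _ hu₀]),
        Finset.image_subset_iff.2 fun u hu => append_mem_pathWords (hUL hu) (by rwa [hUa _ hu])⟩
    · simp only [Finset.mem_insert, Finset.mem_image]
      rintro _ (rfl | ⟨u, hu, rfl⟩)
      · rw [getLastD_append_eq, hUa _ hu₀, hva]
      · rw [getLastD_append_eq, hUa _ hu, hva']
    · rw [Finset.coe_insert, Set.injOn_insert]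
      · refine ⟨?_, ?_⟩
        · rw [Finset.coe_image]
          rintro _ ⟨u, hu, rfl⟩ _ ⟨w, hw, rfl⟩ h
          simp only [← FreeGroup.mul_mk, map_mul, mul_left_inj] at h
          rw [hU hu hw h]
        · rw [Finset.coe_image]
          rintro ⟨_, ⟨u, hu, rfl⟩, h⟩
          exact hne u hu h
      · rw [Finset.coe_image]
        rintro ⟨u, hu, h⟩
        exact hne u hu (by rw [← h])
    · rw [Finset.card_insert_of_notMem, Finset.card_image_of_injective _ hinj, hk]
      rintro h
      obtain ⟨u, hu, h⟩ := Finset.mem_image.1 h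
      exact hne u hu (by rw [← h])

/-- From every letter there start arbitrarily many words of equal length with a given last letter
and distinct images. -/
theorem exists_paths_injOn [Infinite Γ] {φ : FreeGroup α →* Γ}
    (hφ : Function.Surjective φ) (hα : 2 ≤ Fintype.card α) (a : α × Bool) (k : ℕ) :
    ∃ L : ℕ, ∀ p, ∃ U : Finset (List (α × Bool)), U ⊆ pathWords L p ∧
      (∀ u ∈ U, u.getLastD p = a) ∧ Set.InjOn (fun u => φ (FreeGroup.mk u)) U ∧
      U.card = k + 1 := by
  obtain ⟨L, U, hUL, hUa, hU, hk⟩ := exists_loops_injOn hφ hα a k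
  refine ⟨L + 2, fun p => ?_⟩
  obtain ⟨f, hf, ha⟩ := exists_mem_nextLetters hα p a
  refine ⟨U.image fun u => f :: a :: u, ?_, ?_, ?_, ?_⟩
  · exact Finset.image_subset_iff.2 fun u hu =>
      cons_mem_pathWords.2 ⟨hf, cons_mem_pathWords.2 ⟨ha, hUL hu⟩⟩
  · simp only [Finset.mem_image]
    rintro _ ⟨u, hu, rfl⟩
    rw [List.getLastD_cons, List.getLastD_cons, hUa u hu]
  · rw [Finset.coe_image]
    rintro _ ⟨u, hu, rfl⟩ _ ⟨w, hw, rfl⟩ h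
    have key (v : List (α × Bool)) : φ (FreeGroup.mk (f :: a :: v)) =
        φ (FreeGroup.mk [f]) * (φ (FreeGroup.mk [a]) * φ (FreeGroup.mk v)) := by
      rw [FreeGroup.mk_cons f (a :: v), FreeGroup.mk_cons a v, map_mul, map_mul]
    simp only [key, mul_right_inj] at h
    rw [hU hu hw h]
  · rw [Finset.card_image_of_injective _ fun u w h => by simpa using h, hk]

end Loops

/-! ### From path counts to balls -/

theorem ballRatio_ker_eq {α Γ : Type*} [DecidableEq α] [Group Γ] (φ : FreeGroup α →* Γ) (n : ℕ) (ω : FreeGroup α) :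
    ballRatio (φ.ker : Set (FreeGroup α)) n ω =
      ((freeBall α n ∩ {w | φ w = (φ ω)⁻¹}).ncard : ℝ) / ((freeBall α n).ncard : ℝ) := by
  have h : (φ.ker : Set (FreeGroup α)) ∩ ω • freeBall α n =
      (fun w => ω * w) '' (freeBall α n ∩ {w | φ w = (φ ω)⁻¹}) := by
    ext w
    constructor
    · rintro ⟨hw, v, hv, rfl⟩
      refine ⟨v, ⟨hv, ?_⟩, rfl⟩
      have h1 : φ (ω * v) = 1 := hw
      rw [map_mul] at h1
      exact eq_inv_of_mul_eq_one_right h1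
    · rintro ⟨v, ⟨hv, h1⟩, rfl⟩
      refine ⟨?_, v, hv, rfl⟩
      change φ (ω * v) = 1
      rw [map_mul, show φ v = (φ ω)⁻¹ from h1, mul_inv_cancel]
  rw [ballRatio, h, Set.ncard_image_of_injective _ (mul_right_injective ω)]

section Decay

variable {α Γ : Type*} [Fintype α] [DecidableEq α] [Group Γ]

/-- Non-backtracking walks on an infinite group spread out uniformly. -/
theorem exists_forall_pathCount_le [DecidableEq Γ] [Infinite Γ] {φ : FreeGroup α →* Γ}
    (hφ : Function.Surjective φ) (hα : 2 ≤ Fintype.card α) {ε : ℝ} (hε : 0 < ε) :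
    ∃ n₀ : ℕ, ∀ n ≥ n₀, ∀ p g,
      (pathCount φ n p g : ℝ) ≤ ε * ((2 * Fintype.card α - 1 : ℕ) : ℝ) ^ n := by
  obtain ⟨x⟩ : Nonempty α := Fintype.card_pos_iff.1 (by omega)
  obtain ⟨k, hk⟩ := exists_nat_one_div_lt (half_pos hε)
  obtain ⟨L, hL⟩ := exists_paths_injOn hφ hα (x, true) k
  set q : ℝ := ((2 * Fintype.card α - 1 : ℕ) : ℝ) with hq
  have hq1 : (1 : ℝ) ≤ q := by
    rw [hq, Nat.one_le_cast]
    omega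
  set K : ℝ := ((k + 1 : ℕ) : ℝ) with hK
  have hK0 : 0 < K := by positivity
  have hr : 0 < q ^ L := by positivity
  have hKr : K ≤ q ^ L := by
    obtain ⟨U, hUL, -, -, hUk⟩ := hL (x, true)
    have h := Finset.card_le_card hUL
    rw [hUk, card_pathWords] at h
    rw [hK, hq]
    exact_mod_cast h
  -- `1/K` is the fixed point of the affine recursion, whose slope is `1 - K/q^L`.
  have hstep (j : ℕ) : ∀ p g, (pathCount φ (L * j) p g : ℝ) ≤
      (1 / K + (1 - K / q ^ L) ^ j) * q ^ (L * j) := by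
    induction j with
    | zero =>
      intro p g
      have h : (pathCount φ 0 p g : ℝ) ≤ 1 := by exact_mod_cast pathCount_le φ 0 p g
      have h' : 0 < 1 / K := by positivity
      simp only [mul_zero, pow_zero, mul_one]
      linarith
    | succ j ih =>
      intro p g
      obtain ⟨U, hUL, hUa, hU, hUk⟩ := hL p
      rw [Nat.mul_succ, Nat.add_comm (L * j) L]
      refine (pathCount_add_le φ hUL hUa hU hUk ih g).trans_eq ?_
      rw [← hq, ← hK, pow_add, pow_succ]
      field_simp
      ring
  obtain ⟨j, hj⟩ := exists_pow_lt_of_lt_one (half_pos hε)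
    (sub_lt_self (1 : ℝ) (div_pos hK0 hr))
  refine ⟨L * j, fun n hn => ?_⟩
  induction n, hn using Nat.le_induction with
  | base =>
    intro p g
    refine (hstep j p g).trans (mul_le_mul_of_nonneg_right ?_ (by positivity))
    rw [hK, Nat.cast_succ] at *
    linarith
  | succ n hn ih => exact pathCount_succ_le φ ih

/-- A reduced word may follow its own first letter, so it lies in some `pathWords`. Summing over
every `p` overcounts, costing only a constant factor. -/
theorem ncard_freeBall_inter_le [DecidableEq Γ] (φ : FreeGroup α →* Γ) [Nonempty α] (n : ℕ) (g : Γ) :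
    (freeBall α n ∩ {w | φ w = g}).ncard ≤
      ∑ p : α × Bool, ∑ m ∈ Finset.range (n + 1), pathCount φ m p g := by
  set F : Finset (List (α × Bool)) := Finset.univ.biUnion fun p : α × Bool =>
    (Finset.range (n + 1)).biUnion fun m =>
      (pathWords m p).filter fun u => φ (FreeGroup.mk u) = g with hF
  have hmaps : ∀ w ∈ freeBall α n ∩ {w | φ w = g}, w.toWord ∈ (F : Set (List (α × Bool))) := by
    rintro w ⟨hw, hg⟩
    obtain ⟨p, hp⟩ : ∃ p, w.toWord ∈ pathWords w.toWord.length p := by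
      have hred : FreeGroup.IsReduced w.toWord := FreeGroup.isReduced_toWord
      cases h : w.toWord with
      | nil => exact ⟨Classical.arbitrary _, by simp [pathWords]⟩
      | cons x t =>
        rw [h] at hred
        exact ⟨x, cons_mem_pathWords.2 ⟨self_mem_nextLetters x, mem_pathWords.2 ⟨rfl, hred⟩⟩⟩
    rw [hF, Finset.mem_coe]
    refine Finset.mem_biUnion.2 ⟨p, Finset.mem_univ _, Finset.mem_biUnion.2
      ⟨w.toWord.length, Finset.mem_range.2 (Nat.lt_succ_of_le hw), Finset.mem_filter.2 ⟨hp, ?_⟩⟩⟩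
    rw [FreeGroup.mk_toWord]
    exact hg
  refine (Set.ncard_le_ncard_of_injOn _ hmaps FreeGroup.toWord_injective.injOn
    F.finite_toSet).trans ?_
  rw [Set.ncard_coe_finset]
  exact Finset.card_biUnion_le.trans (Finset.sum_le_sum fun p _ => Finset.card_biUnion_le)

theorem pow_le_ncard_freeBall [Nonempty α] (n : ℕ) :
    (2 * Fintype.card α - 1) ^ n ≤ (freeBall α n).ncard := by
  obtain ⟨p⟩ : Nonempty (α × Bool) := inferInstance
  rw [← card_pathWords n p, ← Set.ncard_coe_finset]
  refine Set.ncard_le_ncard_of_injOn FreeGroup.mk (fun u hu => ?_) (fun u hu v hv h => ?_)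
    (freeBall_finite α n)
  · exact FreeGroup.norm_mk_le.trans_eq (mem_pathWords.1 hu).1
  · have hu' : FreeGroup.IsReduced u := (mem_pathWords.1 hu).2.tail
    have hv' : FreeGroup.IsReduced v := (mem_pathWords.1 hv).2.tail
    rw [← hu'.reduce_eq, ← hv'.reduce_eq]
    exact FreeGroup.reduce.sound h

theorem eventually_ballRatio_ker_le [Infinite Γ] {φ : FreeGroup α →* Γ}
    (hφ : Function.Surjective φ) (hα : 2 ≤ Fintype.card α) {ε : ℝ} (hε : 0 < ε) :
    ∀ᶠ n in atTop, ∀ ω, ballRatio (φ.ker : Set (FreeGroup α)) n ω ≤ ε := by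
  classical
  have : Nonempty α := Fintype.card_pos_iff.1 (by omega)
  set q : ℝ := ((2 * Fintype.card α - 1 : ℕ) : ℝ) with hq
  have hq2 : (2 : ℝ) ≤ q := by
    rw [hq, Nat.ofNat_le_cast]
    omega
  set N : ℝ := (Fintype.card (α × Bool) : ℝ) with hN
  have hN0 : 0 < N := Nat.cast_pos.2 Fintype.card_pos
  -- For each of the `N` letters, the geometric sum gives `2δq^n` and the short lengths, `D`, give
  -- at most `δq^n`.
  set δ : ℝ := ε / (3 * N) with hδ
  have hδ0 : 0 < δ := by positivity
  obtain ⟨n₀, hn₀⟩ := exists_forall_pathCount_le hφ hα hδ0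
  set D : ℝ := ∑ m ∈ Finset.range n₀, q ^ m with hD
  have hgeom (n : ℕ) : ∑ m ∈ Finset.range (n + 1), q ^ m ≤ 2 * q ^ n := by
    induction n with
    | zero => simp
    | succ n ih =>
      rw [Finset.sum_range_succ, pow_succ]
      nlinarith [pow_pos (zero_lt_two.trans_le hq2) n]
  have hsum (n : ℕ) (hn : n₀ ≤ n) (p : α × Bool) (g : Γ) :
      ∑ m ∈ Finset.range n, (pathCount φ m p g : ℝ) ≤
        D + δ * ∑ m ∈ Finset.range n, q ^ m := by
    induction n, hn using Nat.le_induction with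
    | base =>
      have h1 : ∑ m ∈ Finset.range n₀, (pathCount φ m p g : ℝ) ≤ D :=
        Finset.sum_le_sum fun m _ => by
          rw [hq]
          exact_mod_cast pathCount_le φ m p g
      have h2 : 0 ≤ δ * ∑ m ∈ Finset.range n₀, q ^ m := by positivity
      linarith
    | succ n hn ih =>
      rw [Finset.sum_range_succ, Finset.sum_range_succ]
      have := hn₀ n hn p g
      linarith
  have hlim : ∀ᶠ n in atTop, D / δ ≤ q ^ n :=
    (tendsto_pow_atTop_atTop_of_one_lt (by linarith)).eventually_ge_atTop _
  filter_upwards [hlim, eventually_ge_atTop n₀] with n hn hnn ω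
  have hqn : 0 < q ^ n := by positivity
  have hball : q ^ n ≤ ((freeBall α n).ncard : ℝ) := by
    rw [hq]
    exact_mod_cast pow_le_ncard_freeBall (α := α) n
  rw [ballRatio_ker_eq]
  refine (div_le_div_of_nonneg_left (Nat.cast_nonneg _) hqn hball).trans ?_
  rw [div_le_iff₀ hqn]
  have h1 : ((freeBall α n ∩ {w | φ w = (φ ω)⁻¹}).ncard : ℝ) ≤
      ∑ p : α × Bool, ∑ m ∈ Finset.range (n + 1), (pathCount φ m p (φ ω)⁻¹ : ℝ) := by
    exact_mod_cast ncard_freeBall_inter_le φ n (φ ω)⁻¹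
  refine h1.trans ((Finset.sum_le_card_nsmul _ _ (3 * δ * q ^ n) fun p _ => ?_).trans_eq ?_)
  · have h2 := hsum (n + 1) (by omega) p (φ ω)⁻¹
    have h3 := mul_le_mul_of_nonneg_left (hgeom n) hδ0.le
    rw [div_le_iff₀ hδ0] at hn
    linarith
  · rw [nsmul_eq_mul, Finset.card_univ, ← hN, hδ]
    field_simp

end Decay

/-! ### One generator -/

section Cyclic

variable {α Γ : Type*} [Fintype α] [Group Γ]

/-- A generator of an infinite cyclic group has infinite order. -/
theorem injective_of_card_eq_one [Infinite Γ] {φ : FreeGroup α →* Γ}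
    (hφ : Function.Surjective φ) (hα : Fintype.card α = 1) : Function.Injective φ := by
  obtain ⟨x, hx⟩ := Fintype.card_eq_one_iff.1 hα
  have hgen (w : FreeGroup α) : ∃ k : ℤ, FreeGroup.of x ^ k = w := by
    have h : w ∈ Subgroup.closure (Set.range (FreeGroup.of : α → FreeGroup α)) := by
      rw [FreeGroup.closure_range_of]
      trivial
    have hr : Set.range (FreeGroup.of : α → FreeGroup α) = {FreeGroup.of x} := by
      ext y
      constructor
      · rintro ⟨z, rfl⟩
        rw [hx z]
        rfl
      · rintro rfl
        exact ⟨x, rfl⟩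
    rwa [hr, Subgroup.mem_closure_singleton] at h
  have hord : orderOf (φ (FreeGroup.of x)) = 0 := by
    refine Infinite.orderOf_eq_zero_of_forall_mem_zpowers fun g => ?_
    obtain ⟨w, rfl⟩ := hφ g
    obtain ⟨k, rfl⟩ := hgen w
    exact ⟨k, (map_zpow φ _ _).symm⟩
  intro v w h
  obtain ⟨k, rfl⟩ := hgen v
  obtain ⟨l, rfl⟩ := hgen w
  rw [map_zpow, map_zpow] at h
  rw [injective_zpow_iff_not_isOfFinOrder.2 (orderOf_eq_zero_iff.1 hord) h]

theorem lt_ncard_freeBall [DecidableEq α] [Nonempty α] (n : ℕ) : n < (freeBall α n).ncard := by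
  obtain ⟨x⟩ := ‹Nonempty α›
  have hinj : Function.Injective fun i : ℕ => FreeGroup.of x ^ i := fun i j h => by
    rw [← FreeGroup.norm_of_pow x i, ← FreeGroup.norm_of_pow x j]
    exact congrArg FreeGroup.norm h
  refine Nat.lt_of_succ_le ?_
  rw [← Finset.card_range n.succ, ← Set.ncard_coe_finset]
  refine Set.ncard_le_ncard_of_injOn _ (fun i hi => ?_) hinj.injOn (freeBall_finite α n)
  exact (FreeGroup.norm_of_pow x i).trans_le
    (Nat.lt_succ_iff.1 (Finset.mem_range.1 hi))

theorem eventually_ballRatio_ker_le_of_injective [DecidableEq α] [Nonempty α] {φ : FreeGroup α →* Γ}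
    (hφ : Function.Injective φ) {ε : ℝ} (hε : 0 < ε) :
    ∀ᶠ n in atTop, ∀ ω, ballRatio (φ.ker : Set (FreeGroup α)) n ω ≤ ε := by
  filter_upwards [tendsto_natCast_atTop_atTop.eventually_ge_atTop (1 / ε)] with n hn ω
  rw [ballRatio_ker_eq]
  have h1 : (freeBall α n ∩ {w | φ w = (φ ω)⁻¹}).ncard ≤ 1 :=
    (Set.ncard_le_one ((freeBall_finite α n).inter_of_left _)).2 fun v hv w hw =>
      hφ (hv.2.trans hw.2.symm)
  have h2 : (n : ℝ) ≤ ((freeBall α n).ncard : ℝ) := Nat.cast_le.2 (lt_ncard_freeBall n).le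
  have h3 : 0 < ((freeBall α n).ncard : ℝ) :=
    Nat.cast_pos.2 ((Nat.zero_le n).trans_lt (lt_ncard_freeBall n))
  rw [div_le_iff₀ h3]
  rw [div_le_iff₀ hε] at hn
  have h4 : ((freeBall α n ∩ {w | φ w = (φ ω)⁻¹}).ncard : ℝ) ≤ 1 := by exact_mod_cast h1
  nlinarith

end Cyclic

/-! ### From uniform smallness to Banach densities -/

section Density

variable {α : Type*} [DecidableEq α]

theorem ballRatio_nonneg (S : Set (FreeGroup α)) (n : ℕ) (ω : FreeGroup α) :
    0 ≤ ballRatio S n ω := by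
  unfold ballRatio
  positivity

theorem ballRatio_compl [Finite α] (S : Set (FreeGroup α)) (n : ℕ) (ω : FreeGroup α) :
    ballRatio Sᶜ n ω = 1 - ballRatio S n ω := by
  have hfin : (ω • freeBall α n).Finite := (freeBall_finite α n).smul_set
  have h := Set.ncard_inter_add_ncard_sdiff_eq_ncard (ω • freeBall α n) S hfin
  have hcard : (ω • freeBall α n).ncard = (freeBall α n).ncard :=
    Set.ncard_image_of_injective _ (MulAction.injective ω)
  have hpos : ((freeBall α n).ncard : ℝ) ≠ 0 := by
    have h1 : (1 : FreeGroup α) ∈ freeBall α n := by simp [freeBall]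
    exact Nat.cast_ne_zero.2 (Set.ncard_ne_zero_of_mem h1 (freeBall_finite α n))
  rw [ballRatio, ballRatio, Set.inter_comm Sᶜ, Set.inter_comm S, ← Set.sdiff_eq,
    eq_sub_iff_add_eq, ← add_div, div_eq_one_iff_eq hpos, ← hcard, ← h, Nat.cast_add, add_comm]

theorem upperBanachDensity_eq_zero [Finite α] {S : Set (FreeGroup α)}
    (h : ∀ ε > 0, ∀ᶠ n in atTop, ∀ ω, ballRatio S n ω ≤ ε) : upperBanachDensity S = 0 := by
  refine Tendsto.limsup_eq (Metric.tendsto_nhds.2 fun ε hε => ?_)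
  filter_upwards [h (ε / 2) (half_pos hε)] with n hn
  obtain ⟨ω, hω⟩ := (ballRatio_iSup_isGreatest S n).1
  rw [← hω, Real.dist_0_eq_abs, abs_of_nonneg (ballRatio_nonneg S n ω)]
  exact (hn ω).trans_lt (half_lt_self hε)

theorem isLBNegligible_of_eventually [Finite α] {S : Set (FreeGroup α)}
    (h : ∀ ε > 0, ∀ᶠ n in atTop, ∀ ω, ballRatio S n ω ≤ ε) : IsLBNegligible S := by
  refine Tendsto.liminf_eq (Metric.tendsto_nhds.2 fun ε hε => ?_)
  filter_upwards [h (ε / 2) (half_pos hε)] with n hn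
  obtain ⟨ω, hω⟩ := (ballRatio_iInf_isLeast Sᶜ n).1
  rw [← hω, ballRatio_compl, dist_comm, Real.dist_eq, sub_sub_cancel,
    abs_of_nonneg (ballRatio_nonneg S n ω)]
  exact (hn ω).trans_lt (half_lt_self hε)

end Density

theorem canonicalProj_surjective {Γ : Type*} [Group Γ] {X : Finset Γ}
    (hX : Subgroup.closure (X : Set Γ) = ⊤) : Function.Surjective (canonicalProj X) := by
  rw [← MonoidHom.range_eq_top, canonicalProj, FreeGroup.range_lift_eq_closure, ← hX]
  congr 1
  exact Subtype.range_coe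

theorem mainTheorem6 {Γ : Type*} [Group Γ] [DecidableEq Γ] [Infinite Γ] (X : Finset Γ)
    (hX : Subgroup.closure (X : Set Γ) = ⊤) :
    upperBanachDensity ((canonicalProj X).ker : Set (FreeGroup X)) = 0 ∧
      IsLBNegligible ((canonicalProj X).ker : Set (FreeGroup X)) := by
  have hsurj := canonicalProj_surjective hX
  have key : ∀ ε > 0, ∀ᶠ n in atTop, ∀ ω,
      ballRatio ((canonicalProj X).ker : Set (FreeGroup X)) n ω ≤ ε := by
    intro ε hε
    rcases lt_or_ge (Fintype.card X) 2 with h | h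
    -- An empty `X` would make `Γ` trivial.
    · have : Nonempty X := by
        by_contra hne
        rw [not_nonempty_iff] at hne
        have := Finite.of_surjective _ hsurj
        exact not_finite Γ
      have h1 : Fintype.card X = 1 := le_antisymm (Nat.lt_succ_iff.1 h) Fintype.card_pos
      exact eventually_ballRatio_ker_le_of_injective (injective_of_card_eq_one hsurj h1) hε
    · exact eventually_ballRatio_ker_le hsurj h hε
  exact ⟨upperBanachDensity_eq_zero key, isLBNegligible_of_eventually key⟩
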